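/- Let $N, L \in \mathbb{N}_+$ and $\Gamma = [-1,1]^N$. Put $m(0)=0$, $m(1) = 1$ and $m(l) = 2^{l-1}+1$ for $l > 1$. Let $\vartheta^0=\emptyset$, $\vartheta^1 = \{0\}$ and, for $l>1$, let $\vartheta^l = \{ -\cos\left(\frac{\pi (j-1)}{m(l)-1}\right) : j = 1,\dots,m(l)\}$ be the Clenshaw-Curtis abscissas. For $x\in\vartheta^l$ let $\psi^l_x(y) = \prod_{z \in \vartheta^l\setminus\{x\}} \frac{y-z}{x-z}$ be the Lagrange polynomial, and let $\mathscr{U}^{m(l)}[v](y) = \sum_{x\in\vartheta^l} v(x)\psi^l_x(y)$, so that $\mathscr{U}^{m(0)}=0$. For $\mathbf{l}\in\mathbb{N}_+^N$ let $g(\mathbf{l}) = \sum_{n=1}^N (l_n-1)$. The isotropic Clenshaw-Curtis Smolyak sparse-grid interpolation operator of level $L$ is $$\mathcal{I}_L[v] = \sum_{g(\mathbf{l})\le L}\ \bigotimes_{n=1}^N\left(\mathscr{U}^{m(l_n)}-\mathscr{U}^{m(l_n-1)}\right)[v] = \sum_{g(\mathbf{l})\le L}\ \sum_{\mathbf{i}\in\{0,1\}^N}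 (-1)^{|\mathbf{i}|}\left(\mathscr{U}^{m(l_1-i_1)}\otimes\cdots\otimes\mathscr{U}^{m(l_N-i_N)}\right)[v].$$ With the sparse grid $\mathcal{H}_L = \bigcup_{g(\mathbf{l})=L} \vartheta^{l_1}\times\cdots\times\vartheta^{l_N}$ it has the form $\mathcal{I}_L[v](y) = \sum_{x\in\mathcal{H}_L} v(x)\,\Psi_{L,x}(y)$, where $$\Psi_{L,x}(y) = \sum_{g(\mathbf{l})\le L}\ \sum_{\substack{\mathbf{i}\in\{0,1\}^N\\ x\in \vartheta^{l_1-i_1}\times\cdots\times\vartheta^{l_N-i_N}}} (-1)^{|\mathbf{i}|}\prod_{n=1}^N \psi^{l_n-i_n}_{x_n}(y_n).$$ Then the Lebesgue constant $\mathbb{L}_L = \max_{y\in\Gamma}\sum_{x\in\mathcal{H}_L} |\Psi_{L,x}(y)|$ satisfies $$\mathbb{L}_L \le \left[(L+1)(L+2)\right]^N.$$ -/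

import Mathlib

namespace SparseGrid

open Finset

noncomputable section

/-- Number of one-dimensional nodes on level `l`: `m(1) = 1` and `m(l) = 2^(l-1) + 1` for `l > 1`.
The value `m(0) = 0` goes with the convention that the interpolation operator of level `0` is
zero. -/
def m : ℕ → ℕ
  | 0 => 0
  | 1 => 1
  | l + 2 => 2 ^ (l + 1) + 1

/-- The one-dimensional Clenshaw-Curtis abscissas of level `l` in `[-1,1]`: the single point `0` on
level `1`, and the points `-cos (π j / (m(l) - 1))`, `j = 0, …, m(l) - 1`, on every level `l > 1`.
(Level `0` has no points.) -/
def nodes : ℕ → Finset ℝ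
  | 0 => ∅
  | 1 => {0}
  | l + 2 => (range (m (l + 2))).image
      fun j : ℕ => -Real.cos (Real.pi * (j : ℝ) / ((m (l + 2) : ℝ) - 1))

/-- The one-dimensional Lagrange polynomial of level `l` that belongs to the node `x`, i.e.
`∏ (y - z) / (x - z)` over the nodes `z ≠ x` of level `l`, evaluated at `y`. -/
def psi (l : ℕ) (x y : ℝ) : ℝ := (Lagrange.basis (nodes l) id x).eval y

/-- The tensor grid `ϑ^{l_1} × ⋯ × ϑ^{l_N}`. -/
def tensorGrid {N : ℕ} (l : Fin N → ℕ) : Finset (Fin N → ℝ) :=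
  Fintype.piFinset fun n => nodes (l n)

/-- The tensor product `U^{m(l_1)} ⊗ ⋯ ⊗ U^{m(l_N)}` of one-dimensional Lagrange interpolation
operators, applied to `v` and evaluated at `y`. It is zero if some `l_n = 0`. -/
def tensorInterp {N : ℕ} (l : Fin N → ℕ) (v : (Fin N → ℝ) → ℝ) (y : Fin N → ℝ) : ℝ :=
  ∑ x ∈ tensorGrid l, v x * ∏ n, psi (l n) (x n) (y n)

/-- The isotropic Smolyak function `g(l) = ∑ (l_n - 1)`, used for `l_n ≥ 1` only. -/
def g {N : ℕ} (l : Fin N → ℕ) : ℕ := ∑ n, (l n - 1)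

/-- The multi-indices `l` with all `l_n ≥ 1` and `g(l) ≤ L` (which forces `l_n ≤ L + 1`). -/
def multiIndices (N L : ℕ) : Finset (Fin N → ℕ) :=
  (Fintype.piFinset fun _ => Icc 1 (L + 1)).filter fun l => g l ≤ L

/-- The set `{0,1}^N`. -/
def binaryIndices (N : ℕ) : Finset (Fin N → ℕ) := Fintype.piFinset fun _ => {0, 1}

/-- The isotropic Clenshaw-Curtis Smolyak operator of level `L`:
`∑_{g(l) ≤ L} ⨂_n (U^{m(l_n)} - U^{m(l_n - 1)})`, expanded over `{0,1}^N`. -/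
def smolyak (N L : ℕ) (v : (Fin N → ℝ) → ℝ) (y : Fin N → ℝ) : ℝ :=
  ∑ l ∈ multiIndices N L, ∑ i ∈ binaryIndices N,
    (-1) ^ (∑ n, i n) * tensorInterp (fun n => l n - i n) v y

/-- The sparse grid of level `L`: the union of the tensor grids with `g(l) = L`. -/
def sparseGrid (N L : ℕ) : Finset (Fin N → ℝ) :=
  ((multiIndices N L).filter fun l => g l = L).biUnion tensorGrid

/-- The sparse-grid Lagrange function of level `L` that belongs to the collocation point `x`:
the signed sum of the tensorized Lagrange polynomials at `x` of all those tensor operators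
`U^{m(l_1 - i_1)} ⊗ ⋯ ⊗ U^{m(l_N - i_N)}` in the Smolyak operator that use the point `x`. -/
def Psi (N L : ℕ) (x y : Fin N → ℝ) : ℝ :=
  ∑ l ∈ multiIndices N L,
    ∑ i ∈ (binaryIndices N).filter fun i => x ∈ tensorGrid fun n => l n - i n,
      (-1) ^ (∑ n, i n) * ∏ n, psi (l n - i n) (x n) (y n)

/-- The domain `Γ = [-1,1]^N`. -/
def Gam (N : ℕ) : Set (Fin N → ℝ) := Set.univ.pi fun _ => Set.Icc (-1) 1

/-- The Lebesgue function `y ↦ ∑_j |Ψ_j(y)|`, summed over the collocation points. -/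
def lebesgueFun (N L : ℕ) (y : Fin N → ℝ) : ℝ := ∑ x ∈ sparseGrid N L, |Psi N L x y|

/-- The Lebesgue constant: the maximum of the Lebesgue function over `Γ`. -/
def lebesgueConst (N L : ℕ) : ℝ := sSup (lebesgueFun N L '' Gam N)

/-- The supremum in the definition of the Lebesgue constant is a maximum. -/
theorem isGreatest_lebesgueConst (N L : ℕ) :
    IsGreatest (lebesgueFun N L '' Gam N) (lebesgueConst N L) := by
  have hc : IsCompact (Gam N) := isCompact_univ_pi fun _ => isCompact_Icc
  have hn : (Gam N).Nonempty := ⟨0, fun n _ => by simp⟩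
  have hf : Continuous (lebesgueFun N L) := by
    unfold lebesgueFun Psi psi
    fun_prop
  exact (hc.image hf).isGreatest_sSup (hn.image _)

/-- The Clenshaw-Curtis abscissas are nested. -/
theorem nodes_subset_succ (l : ℕ) : nodes l ⊆ nodes (l + 1) := by
  match l with
  | 0 => simp [nodes]
  | 1 =>
    intro x hx
    simp only [nodes, mem_singleton] at hx
    subst hx
    simp only [nodes, mem_image, mem_range]
    refine ⟨1, by simp [m], ?_⟩
    have h : Real.pi * ((1 : ℕ) : ℝ) / ((m 2 : ℝ) - 1) = Real.pi / 2 := by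
      norm_num [m]
    rw [show (0 + 2 : ℕ) = 2 from rfl, h, Real.cos_pi_div_two, neg_zero]
  | l + 2 =>
    intro x hx
    simp only [nodes, mem_image, mem_range] at hx ⊢
    obtain ⟨j, hj, rfl⟩ := hx
    refine ⟨2 * j, ?_, ?_⟩
    · simp only [m] at hj ⊢
      rw [pow_succ]
      omega
    · congr 2
      simp only [m]
      push_cast
      rw [pow_succ (2 : ℝ) (l + 1)]
      field_simp
      ring

theorem nodes_mono : Monotone nodes := monotone_nat_of_le_succ nodes_subset_succ

/-- All points used by the Smolyak operator lie in the sparse grid. -/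
theorem tensorGrid_subset_sparseGrid {N L : ℕ} (hN : 1 ≤ N) {l i : Fin N → ℕ}
    (hl : l ∈ multiIndices N L) : (tensorGrid fun n => l n - i n) ⊆ sparseGrid N L := by
  intro x hx
  have hl2 := hl
  simp only [multiIndices, mem_filter, Fintype.mem_piFinset, mem_Icc] at hl2
  obtain ⟨h1, hg⟩ := hl2
  let n0 : Fin N := ⟨0, hN⟩
  let k : Fin N → ℕ := Function.update l n0 (l n0 + (L - g l))
  have hkl : ∀ n, l n ≤ k n := by
    intro n
    by_cases h : n = n0
    · subst h; simp [k]
    · simp [k, h]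
  have hgk : g k = L := by
    have e1 : g k = (k n0 - 1) + ∑ n ∈ univ.erase n0, (k n - 1) :=
      (add_sum_erase _ _ (mem_univ n0)).symm
    have e2 : g l = (l n0 - 1) + ∑ n ∈ univ.erase n0, (l n - 1) :=
      (add_sum_erase _ _ (mem_univ n0)).symm
    have e3 : ∑ n ∈ univ.erase n0, (k n - 1) = ∑ n ∈ univ.erase n0, (l n - 1) := by
      refine sum_congr rfl fun n hn => ?_
      simp [k, (mem_erase.1 hn).1]
    have e4 : k n0 = l n0 + (L - g l) := by simp [k]
    have := (h1 n0).1
    omega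
  have hk1 : ∀ n, k n ≤ L + 1 := by
    intro n
    have : k n - 1 ≤ g k :=
      single_le_sum (f := fun n => k n - 1) (fun _ _ => Nat.zero_le _) (mem_univ n)
    omega
  simp only [sparseGrid, mem_biUnion, mem_filter, multiIndices, Fintype.mem_piFinset, mem_Icc]
  refine ⟨k, ⟨⟨fun n => ⟨(h1 n).1.trans (hkl n), hk1 n⟩, hgk.le⟩, hgk⟩, ?_⟩
  simp only [tensorGrid, Fintype.mem_piFinset] at hx ⊢
  exact fun n => nodes_mono ((Nat.sub_le _ _).trans (hkl n)) (hx n)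

/-- The Smolyak operator in terms of its Lagrange functions. -/
theorem smolyak_eq_sum_Psi {N : ℕ} (hN : 1 ≤ N) (L : ℕ) (v : (Fin N → ℝ) → ℝ) (y : Fin N → ℝ) :
    smolyak N L v y = ∑ x ∈ sparseGrid N L, v x * Psi N L x y := by
  simp only [smolyak, Psi, mul_sum, tensorInterp]
  conv_rhs => rw [sum_comm]
  refine sum_congr rfl fun l hl => ?_
  simp only [sum_filter]
  conv_rhs => rw [sum_comm]
  refine sum_congr rfl fun i _ => ?_
  rw [← sum_filter, filter_mem_eq_inter,
    inter_eq_right.2 (tensorGrid_subset_sparseGrid hN hl)]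
  exact sum_congr rfl fun x _ => by ring

end

end SparseGrid

/-!
Write `Λ_l` for the Lebesgue function of interpolation at the abscissas of level `l`. Expanding the
Smolyak operator and dropping the constraint `g(l) ≤ L` bounds the sparse-grid Lebesgue function by
`∏ n, ∑ l ∈ [1, L + 1], (Λ_l + Λ_{l-1}) (y n)`, so it suffices that `Λ_l + Λ_{l-1} ≤ 2 l`.

For `l > 1` the abscissas are the extrema `cos (j π / n)`, `0 ≤ j ≤ n = 2 ^ (l - 1)`, of the
Chebyshev polynomial `T_n`. At `y = cos (x π / n)` their Lagrange basis is obtained by symmetrizing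
the trigonometric cardinal functions of `2 n` equidistant points, so `Λ_l` is at most the sum of a
periodic kernel over a full period. Once the period is centred at `x`, the kernel is dominated by
`|sinc (π (x - j))|`, which gives `Λ_l ≤ 2 + (2 / π) H_{n-1} ≤ 2 + (2 / π) (l - 1)`.
-/

namespace SparseGrid

open Finset Polynomial
open Real (cos sin cot sinc)
open scoped Real

/-- The Lebesgue function of polynomial interpolation at the points of `s`. -/
noncomputable def lagrangeLebesgueFun (s : Finset ℝ) (y : ℝ) : ℝ :=
  ∑ x ∈ s, |(Lagrange.basis s id x).eval y|

theorem lagrangeLebesgueFun_nonneg (s : Finset ℝ) (y : ℝ) : 0 ≤ lagrangeLebesgueFun s y :=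
  sum_nonneg fun _ _ => abs_nonneg _

theorem lagrangeLebesgueFun_of_mem {s : Finset ℝ} {y : ℝ} (hy : y ∈ s) :
    lagrangeLebesgueFun s y = 1 := by
  rw [lagrangeLebesgueFun, sum_eq_single_of_mem y hy fun x _ hxy => by
    simpa using Lagrange.eval_basis_of_ne (v := id) hxy hy]
  simpa using congrArg abs (Lagrange.eval_basis_self (v := id) (Set.injOn_id _) hy)

theorem eval_derivative_mul_eval_basis {F ι : Type*} [Field F] [DecidableEq ι] {s : Finset ι}
    {v : ι → F} (hv : Set.InjOn v s) {W : F[X]} (hdeg : W.degree = #s)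
    (hroot : ∀ i ∈ s, W.eval (v i) = 0) {i : ι} (hi : i ∈ s) {y : F} (hy : y ≠ v i) :
    (derivative W).eval (v i) * (Lagrange.basis s v i).eval y = W.eval y / (y - v i) := by
  have hlead : W.leadingCoeff ≠ 0 := by
    rw [leadingCoeff_ne_zero, ← degree_ne_bot, hdeg]
    exact WithBot.natCast_ne_bot _
  have hW : W = C W.leadingCoeff * Lagrange.nodal s v := by
    refine eq_of_degree_le_of_eval_index_eq s hv hdeg.le ?_ ?_ fun j hj => ?_
    · rw [degree_C_mul hlead, Lagrange.degree_nodal, hdeg]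
    · rw [leadingCoeff_mul, leadingCoeff_C, Lagrange.nodal_monic.leadingCoeff, mul_one]
    · rw [hroot j hj, eval_mul, Lagrange.eval_nodal_at_node hj, mul_zero]
  generalize W.leadingCoeff = c at hW
  have hweight := Lagrange.nodalWeight_ne_zero hv hi
  rw [Lagrange.nodalWeight_eq_eval_derivative_nodal hi] at hweight
  rw [Lagrange.eval_basis_not_at_node hi hy, Lagrange.nodalWeight_eq_eval_derivative_nodal hi, hW,
    derivative_C_mul, eval_C_mul, eval_C_mul]
  have hderiv := inv_ne_zero hweight
  rw [inv_inv] at hderiv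
  field_simp

/-- The extrema `cos (j π / n)`, `0 ≤ j ≤ n`, of the Chebyshev polynomial `T_n` on `[-1, 1]`. -/
noncomputable def chebyshevExtrema (n : ℕ) : Finset ℝ :=
  (range (n + 1)).image (Chebyshev.node n)

/-- The polynomial `(X ^ 2 - 1) U_{n-1}`, whose roots are the extrema of `T_n` on `[-1, 1]`. For
`n = 0` it is the zero polynomial, as `U_{-1} = 0`. -/
noncomputable def extremaPoly (n : ℕ) : ℝ[X] := (X ^ 2 - 1) * Chebyshev.U ℝ (n - 1)

theorem node_mem_chebyshevExtrema {n j : ℕ} (hj : j ≤ n) :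
    Chebyshev.node n j ∈ chebyshevExtrema n :=
  mem_image_of_mem _ (mem_range_succ_iff.2 hj)

theorem injOn_node (n : ℕ) : Set.InjOn (Chebyshev.node n) (range (n + 1)) :=
  (Chebyshev.strictAntiOn_node n).injOn

theorem degree_extremaPoly {n : ℕ} (hn : n ≠ 0) :
    (extremaPoly n).degree = #(chebyshevExtrema n) := by
  have hquad : (X ^ 2 - 1 : ℝ[X]).degree = 2 := by compute_degree!
  obtain ⟨p, rfl⟩ := Nat.exists_eq_succ_of_ne_zero hn
  rw [extremaPoly, degree_mul, hquad, Nat.cast_succ, add_sub_cancel_right,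
    Chebyshev.degree_U_natCast, chebyshevExtrema, card_image_of_injOn (injOn_node _), card_range]
  norm_cast
  omega

theorem eval_cos_extremaPoly (n : ℕ) (t : ℝ) :
    (extremaPoly n).eval (cos t) = -(sin t * sin (n * t)) := by
  have hU := Chebyshev.U_real_cos t (n - 1)
  rw [Int.cast_sub, Int.cast_natCast, Int.cast_one, sub_add_cancel] at hU
  simp only [extremaPoly, eval_mul, eval_sub, eval_pow, eval_X, eval_one]
  rw [← hU]
  linear_combination (Chebyshev.U ℝ (n - 1)).eval (cos t) * Real.sin_sq_add_cos_sq t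

theorem eval_node_extremaPoly {n : ℕ} (hn : n ≠ 0) (j : ℕ) :
    (extremaPoly n).eval (Chebyshev.node n j) = 0 := by
  rw [Chebyshev.node, eval_cos_extremaPoly, mul_div_cancel₀ _ (Nat.cast_ne_zero.2 hn),
    Real.sin_nat_mul_pi, mul_zero, neg_zero]

theorem abs_eval_derivative_extremaPoly_of_sq_eq_one (n : ℕ) {x : ℝ} (hx : x ^ 2 = 1) :
    |(derivative (extremaPoly n)).eval x| = 2 * n := by
  have hU : |(Chebyshev.U ℝ (n - 1)).eval x| = n := by
    rcases sq_eq_one_iff.1 hx with rfl | rfl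
    · simp
    · rcases Int.even_or_odd ((n : ℤ) - 1) with h | h <;>
        simp [Chebyshev.U_eval_neg_one, Int.negOnePow_even, Int.negOnePow_odd, h]
  have hderiv : (derivative (extremaPoly n)).eval x = 2 * x * (Chebyshev.U ℝ (n - 1)).eval x := by
    simp [extremaPoly, derivative_mul, hx, one_add_one_eq_two]
  have habs : |x| = 1 := by
    rcases sq_eq_one_iff.1 hx with rfl | rfl <;> simp
  rw [hderiv, abs_mul, hU, abs_mul, abs_two, habs, mul_one]

theorem abs_eval_derivative_extremaPoly_node {n j : ℕ} (h0 : 0 < j) (hj : j < n) :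
    |(derivative (extremaPoly n)).eval (Chebyshev.node n j)| = n := by
  have hn : n ≠ 0 := by omega
  have hlt_one : Chebyshev.node n j < 1 := by
    simpa only [Chebyshev.node_eq_one] using Chebyshev.node_lt hj.le h0
  have hneg_one_lt : -1 < Chebyshev.node n j := by
    simpa only [Chebyshev.node_eq_neg_one hn] using Chebyshev.node_lt le_rfl hj
  have hU : (Chebyshev.U ℝ (n - 1)).eval (Chebyshev.node n j) = 0 := by
    have hroot := eval_node_extremaPoly hn j
    simp only [extremaPoly, eval_mul, eval_sub, eval_pow, eval_X, eval_one] at hroot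
    exact (mul_eq_zero.1 hroot).resolve_left (by nlinarith)
  have hT : |(Chebyshev.T ℝ n).eval (Chebyshev.node n j)| = 1 := by
    simp [Chebyshev.eval_T_real_node (mem_Iic.2 hj.le)]
  have hderiv : derivative (extremaPoly n) =
      X * Chebyshev.U ℝ (n - 1) + (n : ℝ[X]) * Chebyshev.T ℝ n := by
    have h := Chebyshev.add_one_mul_T_eq_poly_in_U (R := ℝ) (n - 1)
    simp only [Int.cast_sub, Int.cast_natCast, Int.cast_one, sub_add_cancel] at h
    simp only [extremaPoly, derivative_mul, derivative_sub, derivative_X_sq, derivative_one,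
      map_ofNat]
    linear_combination -h
  rw [hderiv, eval_add, eval_mul, eval_mul, hU, mul_zero, zero_add, eval_natCast, abs_mul, hT,
    mul_one, Nat.abs_cast]

theorem sin_div_cos_sub_cos {t s : ℝ} (h : cos t ≠ cos s) :
    sin t / (cos t - cos s) = -(cot ((t - s) / 2) + cot ((t + s) / 2)) / 2 := by
  have hcos := Real.cos_sub_cos t s
  have hsum : sin ((t + s) / 2) ≠ 0 := fun h0 => h (by rw [h0] at hcos; linarith)
  have hdiff : sin ((t - s) / 2) ≠ 0 := fun h0 => h (by rw [h0] at hcos; linarith)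
  have hsin : sin t =
      sin ((t + s) / 2) * cos ((t - s) / 2) + cos ((t + s) / 2) * sin ((t - s) / 2) := by
    rw [← Real.sin_add]
    ring_nf
  rw [hcos, hsin, Real.cot_eq_cos_div_sin, Real.cot_eq_cos_div_sin]
  field_simp

/-- The modulus of the trigonometric cardinal function `sin (n s) cot (s / 2) / (2 n)` of the `2 n`
equidistant points `k π / n`, in the variable `u = n s / π` that turns these points into integers.
Since `cot 0 = 0` in Mathlib, its value at `u = 0` is the junk value `0` in place of `1`. -/
noncomputable def cardinalKernel (n : ℕ) (u : ℝ) : ℝ :=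
  |sin (π * u)| * |cot (u * π / n / 2)| / (2 * n)

theorem cardinalKernel_periodic {n : ℕ} (hn : n ≠ 0) :
    Function.Periodic (cardinalKernel n) (2 * n) := by
  intro u
  have hsin : sin (π * (u + 2 * n)) = sin (π * u) := by
    rw [show π * (u + 2 * n) = π * u + n * (2 * π) by ring, Real.sin_add_nat_mul_two_pi]
  have harg : (u + 2 * n) * π / n / 2 = u * π / n / 2 + π := by field_simp
  rw [cardinalKernel, hsin, harg, Real.cot_eq_cos_div_sin, Real.cos_add_pi, Real.sin_add_pi,
    neg_div_neg_eq, ← Real.cot_eq_cos_div_sin, cardinalKernel]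

theorem abs_eval_derivative_mul_abs_eval_basis_node_le {n j : ℕ} (hn : n ≠ 0) (hj : j ≤ n) {x : ℝ}
    (hx : cos (x * π / n) ∉ chebyshevExtrema n) :
    |(derivative (extremaPoly n)).eval (Chebyshev.node n j)| *
        |(Lagrange.basis (chebyshevExtrema n) id (Chebyshev.node n j)).eval (cos (x * π / n))| ≤
      n * (cardinalKernel n (x - j) + cardinalKernel n (x + j)) := by
  have hmem := node_mem_chebyshevExtrema hj
  have hne : cos (x * π / n) ≠ cos (j * π / n) := fun h => hx (h ▸ hmem)
  have hroot : ∀ z ∈ chebyshevExtrema n, (extremaPoly n).eval (id z) = 0 := by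
    intro z hz
    obtain ⟨i, -, rfl⟩ := mem_image.1 hz
    exact eval_node_extremaPoly hn i
  have hbasis := eval_derivative_mul_eval_basis (Set.injOn_id _) (degree_extremaPoly hn) hroot hmem
    hne
  have hcot : (extremaPoly n).eval (cos (x * π / n)) / (cos (x * π / n) - cos (j * π / n)) =
      sin (π * x) * (cot ((x - j) * π / n / 2) + cot ((x + j) * π / n / 2)) / 2 := by
    rw [eval_cos_extremaPoly, ← neg_mul, mul_div_right_comm, neg_div, sin_div_cos_sub_cos hne,
      mul_div_cancel₀ _ (Nat.cast_ne_zero.2 hn)]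
    ring_nf
  have hsin_sub : |sin (π * (x - j))| = |sin (π * x)| := by
    rw [mul_sub, mul_comm _ (j : ℝ), Real.sin_sub_nat_mul_pi]
    simp [abs_mul]
  have hsin_add : |sin (π * (x + j))| = |sin (π * x)| := by
    rw [mul_add, mul_comm _ (j : ℝ), Real.sin_add_nat_mul_pi]
    simp [abs_mul]
  rw [← abs_mul]
  refine (congrArg abs (hbasis.trans hcot)).trans_le ?_
  rw [abs_div, abs_mul, abs_two, cardinalKernel, cardinalKernel, hsin_sub, hsin_add]
  calc _ ≤ |sin (π * x)| * (|cot ((x - j) * π / n / 2)| + |cot ((x + j) * π / n / 2)|) / 2 := by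
        gcongr
        exact abs_add_le _ _
    _ = _ := by field_simp

theorem abs_eval_basis_node_le_of_sq_eq_one {n j : ℕ} (hn : n ≠ 0) (hj : j ≤ n)
    (hsq : Chebyshev.node n j ^ 2 = 1) {x : ℝ} (hx : cos (x * π / n) ∉ chebyshevExtrema n) :
    |(Lagrange.basis (chebyshevExtrema n) id (Chebyshev.node n j)).eval (cos (x * π / n))| ≤
      (cardinalKernel n (x - j) + cardinalKernel n (x + j)) / 2 := by
  have hn_pos : (0 : ℝ) < n := by positivity
  have h := abs_eval_derivative_mul_abs_eval_basis_node_le hn hj hx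
  rw [abs_eval_derivative_extremaPoly_of_sq_eq_one n hsq] at h
  refine le_of_mul_le_mul_left (h.trans_eq ?_) (mul_pos two_pos hn_pos)
  ring

theorem abs_eval_basis_node_le {n j : ℕ} (h0 : 0 < j) (hj : j < n) {x : ℝ}
    (hx : cos (x * π / n) ∉ chebyshevExtrema n) :
    |(Lagrange.basis (chebyshevExtrema n) id (Chebyshev.node n j)).eval (cos (x * π / n))| ≤
      cardinalKernel n (x - j) + cardinalKernel n (x + j) := by
  have h := abs_eval_derivative_mul_abs_eval_basis_node_le (by omega) hj.le hx
  rw [abs_eval_derivative_extremaPoly_node h0 hj] at h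
  exact le_of_mul_le_mul_left h (Nat.cast_pos.2 (h0.trans hj))

theorem sum_range_symm_of_periodic {M : Type*} [AddCommGroup M] {f : ℤ → M} {n : ℕ}
    (hf : Function.Periodic f (2 * n)) (c : ℤ) :
    ∑ r ∈ range n, (f (c - r) + f (c + 1 + r)) = ∑ r ∈ range n, (f (-r) + f (1 + r)) := by
  have hshift : Function.Periodic (fun c : ℤ => ∑ r ∈ range n, (f (c - r) + f (c + 1 + r))) 1 := by
    intro c
    have hend : f (c + 1 + n) = f (c + 1 - n) := by
      rw [← hf (c + 1 - n)]
      ring_nf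
    have htele := sum_range_sub' (fun r : ℕ => f (c + 1 - r) - f (c + 1 + r)) n
    simp only [Nat.cast_zero, sub_zero, add_zero, sub_self, hend, sub_zero] at htele
    rw [← sub_eq_zero, ← sum_sub_distrib, ← htele]
    refine sum_congr rfl fun r _ => ?_
    rw [show c + 1 - (r + 1 : ℕ) = c - r by push_cast; ring,
      show c + 1 + (r + 1 : ℕ) = c + 1 + 1 + r by push_cast; ring]
    abel
  simpa using hshift.int_mul_eq c

theorem lagrangeLebesgueFun_chebyshevExtrema_le_sum {p : ℕ} {x : ℝ}
    (hx : cos (x * π / (p + 1 : ℕ)) ∉ chebyshevExtrema (p + 1)) :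
    lagrangeLebesgueFun (chebyshevExtrema (p + 1)) (cos (x * π / (p + 1 : ℕ))) ≤
      ∑ r ∈ range (p + 1),
        (cardinalKernel (p + 1) (x + r) + cardinalKernel (p + 1) (x - (r + 1))) := by
  set n := p + 1 with hn_def
  have hn : n ≠ 0 := p.succ_ne_zero
  set ℓ : ℕ → ℝ := fun j => |(Lagrange.basis (chebyshevExtrema n) id (Chebyshev.node n j)).eval
    (cos (x * π / n))|
  have hfirst : ℓ 0 ≤ cardinalKernel n x := by
    simpa using
      abs_eval_basis_node_le_of_sq_eq_one hn n.zero_le (by simp [Chebyshev.node_eq_one]) hx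
  have hlast : ℓ n ≤ cardinalKernel n (x - n) := by
    have hperiod : cardinalKernel n (x + n) = cardinalKernel n (x - n) := by
      rw [← cardinalKernel_periodic hn (x - n)]
      ring_nf
    simpa [hperiod] using
      abs_eval_basis_node_le_of_sq_eq_one hn le_rfl (by simp [Chebyshev.node_eq_neg_one hn]) hx
  have hinner : ∀ r ∈ range p, ℓ (r + 1) ≤
      cardinalKernel n (x - (r + 1 : ℕ)) + cardinalKernel n (x + (r + 1 : ℕ)) := fun r hr =>
    abs_eval_basis_node_le r.succ_pos (Nat.succ_lt_succ (mem_range.1 hr)) hx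
  rw [lagrangeLebesgueFun]
  nth_rw 1 [chebyshevExtrema]
  rw [sum_image (injOn_node _)]
  calc ∑ j ∈ range (n + 1), ℓ j = ∑ r ∈ range p, ℓ (r + 1) + ℓ 0 + ℓ n := by
        rw [sum_range_succ, sum_range_succ']
    _ ≤ ∑ r ∈ range p, (cardinalKernel n (x - (r + 1 : ℕ)) + cardinalKernel n (x + (r + 1 : ℕ))) +
          cardinalKernel n x + cardinalKernel n (x - n) := by
        gcongr with r hr
        exact hinner r hr
    _ = _ := by
        rw [sum_add_distrib, sum_add_distrib, sum_range_succ' _ p, sum_range_succ _ p, hn_def]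
        push_cast
        rw [add_zero]
        ring

theorem abs_cot_le_inv_abs {x : ℝ} (hx : |x| ≤ π / 2) : |cot x| ≤ |x|⁻¹ := by
  wlog h0 : 0 ≤ x generalizing x
  · simpa [Real.cot_eq_cos_div_sin, abs_div] using this (x := -x) (by simpa) (by linarith)
  rw [abs_of_nonneg h0] at hx
  rcases hx.eq_or_lt with rfl | hlt
  · rw [Real.cot_eq_cos_div_sin, Real.cos_pi_div_two, zero_div, abs_zero]
    positivity
  rcases h0.eq_or_lt with rfl | hpos
  · simp [Real.cot_eq_cos_div_sin]
  rw [Real.cot_eq_cos_div_sin, ← inv_div, ← Real.tan_eq_sin_div_cos, abs_inv]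
  gcongr
  exact Real.le_tan h0 hlt

theorem cardinalKernel_le_abs_sinc (n : ℕ) {u : ℝ} (hu : |u| ≤ n) :
    cardinalKernel n u ≤ |sinc (π * u)| := by
  rcases n.eq_zero_or_pos with rfl | hn
  · simp [cardinalKernel]
  rcases eq_or_ne u 0 with rfl | hu0
  · simp [cardinalKernel]
  have hn' : (0 : ℝ) < n := Nat.cast_pos.2 hn
  have harg : |u * π / n / 2| = |u| * π / n / 2 := by
    rw [abs_div, abs_div, abs_mul, abs_of_pos Real.pi_pos, abs_of_pos hn', abs_two]
  have hcot : |cot (u * π / n / 2)| ≤ (|u| * π / n / 2)⁻¹ := by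
    rw [← harg]
    refine abs_cot_le_inv_abs ?_
    rw [harg]
    gcongr
    rw [div_le_iff₀ hn', mul_comm]
    gcongr
  calc cardinalKernel n u
      ≤ |sin (π * u)| * (|u| * π / n / 2)⁻¹ / (2 * n) := by
        rw [cardinalKernel]
        gcongr
    _ = |sinc (π * u)| := by
        rw [Real.sinc_of_ne_zero (mul_ne_zero Real.pi_ne_zero hu0), abs_div, abs_mul π,
          abs_of_pos Real.pi_pos]
        field_simp

theorem abs_sinc_pi_mul_le {r v : ℝ} (hr : 0 < r) (hv : r ≤ v) :
    |sinc (π * v)| ≤ 1 / π * r⁻¹ := by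
  have hv0 : 0 < π * v := mul_pos Real.pi_pos (hr.trans_le hv)
  rw [Real.sinc_of_ne_zero hv0.ne', abs_div, abs_of_pos hv0, one_div_mul_eq_div, inv_eq_one_div,
    div_div, mul_comm r]
  gcongr
  exact Real.abs_sin_le_one _

theorem sum_abs_sinc_le {u : ℝ} (hu : u ∈ Set.Icc 0 1) (p : ℕ) :
    ∑ r ∈ range (p + 1), (|sinc (π * (r + u))| + |sinc (π * (r + (1 - u)))|) ≤
      2 + 2 / π * harmonic p := by
  have htail : ∀ r ∈ range p, |sinc (π * ((r + 1 : ℕ) + u))| +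
      |sinc (π * ((r + 1 : ℕ) + (1 - u)))| ≤ 2 / π * ((r + 1 : ℕ) : ℝ)⁻¹ := by
    intro r _
    have hr : (0 : ℝ) < (r + 1 : ℕ) := by positivity
    have hleft := abs_sinc_pi_mul_le hr (le_add_of_nonneg_right hu.1)
    have hright := abs_sinc_pi_mul_le hr (le_add_of_nonneg_right (sub_nonneg.2 hu.2))
    exact (add_le_add hleft hright).trans_eq (by ring)
  rw [sum_range_succ', harmonic, Rat.cast_sum, mul_sum, add_comm]
  refine add_le_add ?_ ?_
  · exact (add_le_add (Real.abs_sinc_le_one _) (Real.abs_sinc_le_one _)).trans_eq one_add_one_eq_two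
  · simpa using sum_le_sum htail

theorem exists_cos_mul_pi_div_eq {n : ℕ} (hn : n ≠ 0) {y : ℝ} (hy : y ∈ Set.Icc (-1) 1) :
    ∃ x : ℝ, cos (x * π / n) = y := by
  have hn' : (n : ℝ) ≠ 0 := Nat.cast_ne_zero.2 hn
  refine ⟨n * Real.arccos y / π, ?_⟩
  rw [div_mul_cancel₀ _ Real.pi_ne_zero, mul_div_cancel_left₀ _ hn', Real.cos_arccos hy.1 hy.2]

theorem sum_cardinalKernel_le_sum_abs_sinc (p : ℕ) (x : ℝ) :
    ∑ r ∈ range (p + 1), (cardinalKernel (p + 1) (x + r) + cardinalKernel (p + 1) (x - (r + 1))) ≤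
      ∑ r ∈ range (p + 1), (|sinc (π * (r + Int.fract x))| +
        |sinc (π * (r + (1 - Int.fract x)))|) := by
  have hperiodic : Function.Periodic (fun j : ℤ => cardinalKernel (p + 1) (x - j))
      (2 * (p + 1 : ℕ)) := by
    intro j
    have h := (cardinalKernel_periodic p.succ_ne_zero).sub_eq (x - j)
    push_cast [sub_sub] at h ⊢
    exact h
  have hfract := Int.fract_nonneg x
  have hfract' := (Int.fract_lt_one x).le
  have hcentre := sum_range_symm_of_periodic hperiodic ⌊x⌋
  simp only [Int.cast_neg, Int.cast_natCast, sub_neg_eq_add, Int.cast_add, Int.cast_one,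
    Int.cast_sub, add_comm (1 : ℝ)] at hcentre
  rw [← hcentre]
  refine sum_le_sum fun r hr => ?_
  have hr' : (r : ℝ) ≤ p := Nat.cast_le.2 (mem_range_succ_iff.1 hr)
  have hleft : x - (⌊x⌋ - r) = r + Int.fract x := by
    rw [Int.fract]
    ring
  have hright : x - (⌊x⌋ + 1 + r) = -(r + (1 - Int.fract x)) := by
    rw [Int.fract]
    ring
  rw [hleft, hright, ← Real.sinc_neg (π * (r + (1 - _))), ← mul_neg]
  gcongr <;> refine cardinalKernel_le_abs_sinc _ (abs_le.2 ?_) <;> push_cast <;>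
    constructor <;> linarith

theorem harmonic_nonneg (p : ℕ) : 0 ≤ harmonic p :=
  sum_nonneg fun _ _ => by positivity

theorem lagrangeLebesgueFun_chebyshevExtrema_le (p : ℕ) {y : ℝ} (hy : y ∈ Set.Icc (-1) 1) :
    lagrangeLebesgueFun (chebyshevExtrema (p + 1)) y ≤ 2 + 2 / π * harmonic p := by
  by_cases hmem : y ∈ chebyshevExtrema (p + 1)
  · have hharm : (0 : ℝ) ≤ harmonic p := Rat.cast_nonneg.2 (harmonic_nonneg p)
    have hterm : 0 ≤ 2 / π * harmonic p := by positivity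
    rw [lagrangeLebesgueFun_of_mem hmem]
    linarith
  obtain ⟨x, rfl⟩ := exists_cos_mul_pi_div_eq p.succ_ne_zero hy
  have hfract : Int.fract x ∈ Set.Icc 0 1 := ⟨Int.fract_nonneg x, (Int.fract_lt_one x).le⟩
  exact (lagrangeLebesgueFun_chebyshevExtrema_le_sum hmem).trans
    ((sum_cardinalKernel_le_sum_abs_sinc p x).trans (sum_abs_sinc_le hfract p))

theorem harmonic_two_pow_sub_one_le (k : ℕ) : harmonic (2 ^ k - 1) ≤ k := by
  have hIco : Icc 1 (2 ^ k - 1) = Ico 1 (2 ^ k) := by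
    ext i
    simp only [mem_Icc, mem_Ico]
    have := Nat.one_le_two_pow (n := k)
    omega
  have hanti : ∀ ⦃i j : ℕ⦄, 0 < i → i ≤ j → (j : ℚ)⁻¹ ≤ (i : ℚ)⁻¹ := fun i j hi hij => by gcongr
  rw [harmonic_eq_sum_Icc, hIco]
  exact (le_sum_condensed' hanti k).trans_eq (by simp)

theorem nodes_eq_chebyshevExtrema (k : ℕ) : nodes (k + 2) = chebyshevExtrema (2 ^ (k + 1)) := by
  have hm : (m (k + 2) : ℝ) - 1 = (2 ^ (k + 1) : ℕ) := by simp [m]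
  have hreflect : ∀ j ∈ range (2 ^ (k + 1) + 1),
      -cos (π * j / (2 ^ (k + 1) : ℕ)) = Chebyshev.node (2 ^ (k + 1)) (2 ^ (k + 1) - j) := by
    intro j hj
    rw [Chebyshev.node, ← Real.cos_pi_sub, Nat.cast_sub (mem_range_succ_iff.1 hj)]
    congr 1
    field_simp
  calc nodes (k + 2)
      = (range (2 ^ (k + 1) + 1)).image
          fun j => Chebyshev.node (2 ^ (k + 1)) (2 ^ (k + 1) - j) := by
        rw [nodes, hm, m, image_congr hreflect]
    _ = chebyshevExtrema (2 ^ (k + 1)) := by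
        conv_rhs => rw [chebyshevExtrema, ← range_image_pred_top_sub, image_image]
        rfl

theorem lagrangeLebesgueFun_nodes_zero (y : ℝ) : lagrangeLebesgueFun (nodes 0) y = 0 := by
  simp [lagrangeLebesgueFun, nodes]

theorem lagrangeLebesgueFun_nodes_one (y : ℝ) : lagrangeLebesgueFun (nodes 1) y = 1 := by
  simp [lagrangeLebesgueFun, nodes]

theorem lagrangeLebesgueFun_nodes_le (k : ℕ) {y : ℝ} (hy : y ∈ Set.Icc (-1) 1) :
    lagrangeLebesgueFun (nodes (k + 2)) y ≤ 2 + 2 / 3 * (k + 1) := by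
  have hpow : 2 ^ (k + 1) - 1 + 1 = 2 ^ (k + 1) := Nat.sub_add_cancel Nat.one_le_two_pow
  have hharm : (harmonic (2 ^ (k + 1) - 1) : ℝ) ≤ k + 1 := by
    exact_mod_cast harmonic_two_pow_sub_one_le (k + 1)
  rw [nodes_eq_chebyshevExtrema, ← hpow]
  refine (lagrangeLebesgueFun_chebyshevExtrema_le _ hy).trans ?_
  have hharm_nonneg : (0 : ℝ) ≤ harmonic (2 ^ (k + 1) - 1) := Rat.cast_nonneg.2 (harmonic_nonneg _)
  have hpi := Real.pi_gt_three
  gcongr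

theorem lagrangeLebesgueFun_nodes_add_le (l : ℕ) {y : ℝ} (hy : y ∈ Set.Icc (-1) 1) :
    lagrangeLebesgueFun (nodes (l + 1)) y + lagrangeLebesgueFun (nodes l) y ≤ 2 * (l + 1) := by
  match l with
  | 0 => norm_num [lagrangeLebesgueFun_nodes_zero, lagrangeLebesgueFun_nodes_one]
  | 1 =>
    have h : lagrangeLebesgueFun (nodes 2) y ≤ 2 + 2 / 3 := by
      simpa using lagrangeLebesgueFun_nodes_le 0 hy
    rw [lagrangeLebesgueFun_nodes_one, Nat.cast_one]
    linarith
  | k + 2 =>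
    have hsucc := lagrangeLebesgueFun_nodes_le (k + 1) hy
    have hself := lagrangeLebesgueFun_nodes_le k hy
    push_cast at hsucc ⊢
    linarith [k.cast_nonneg (α := ℝ)]

theorem sum_lagrangeLebesgueFun_nodes_le (L : ℕ) {y : ℝ} (hy : y ∈ Set.Icc (-1) 1) :
    ∑ l ∈ Icc 1 (L + 1),
        (lagrangeLebesgueFun (nodes l) y + lagrangeLebesgueFun (nodes (l - 1)) y) ≤
      ((L : ℝ) + 1) * ((L : ℝ) + 2) := by
  induction L with
  | zero => simpa using lagrangeLebesgueFun_nodes_add_le 0 hy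
  | succ L ih =>
    have hterm := lagrangeLebesgueFun_nodes_add_le (L + 1) hy
    rw [sum_Icc_succ_top (by omega), Nat.add_sub_cancel]
    push_cast at hterm ⊢
    linarith

theorem sum_tensorGrid_abs_prod_psi {N : ℕ} (l : Fin N → ℕ) (y : Fin N → ℝ) :
    ∑ x ∈ tensorGrid l, |∏ n, psi (l n) (x n) (y n)| =
      ∏ n, lagrangeLebesgueFun (nodes (l n)) (y n) := by
  simp only [lagrangeLebesgueFun, abs_prod, tensorGrid, prod_univ_sum, psi]

theorem sum_binaryIndices_prod {R : Type*} [CommSemiring R] {N : ℕ} (F : Fin N → ℕ → R) :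
    ∑ i ∈ binaryIndices N, ∏ n, F n (i n) = ∏ n, (F n 0 + F n 1) := by
  rw [binaryIndices, ← prod_univ_sum]
  simp

theorem lebesgueFun_le_sum {N : ℕ} (hN : 1 ≤ N) (L : ℕ) (y : Fin N → ℝ) :
    lebesgueFun N L y ≤ ∑ l ∈ multiIndices N L, ∑ i ∈ binaryIndices N,
      ∏ n, lagrangeLebesgueFun (nodes (l n - i n)) (y n) := by
  calc lebesgueFun N L y
      ≤ ∑ x ∈ sparseGrid N L, ∑ l ∈ multiIndices N L,
          ∑ i ∈ (binaryIndices N).filter fun i => x ∈ tensorGrid fun n => l n - i n,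
            |∏ n, psi (l n - i n) (x n) (y n)| := by
        refine sum_le_sum fun x _ => ?_
        refine (abs_sum_le_sum_abs _ _).trans (sum_le_sum fun l _ => ?_)
        refine (abs_sum_le_sum_abs _ _).trans (sum_le_sum fun i _ => ?_)
        rw [abs_mul, abs_neg_one_pow, one_mul]
    _ = _ := by
        rw [sum_comm]
        refine sum_congr rfl fun l hl => ?_
        simp only [sum_filter]
        rw [sum_comm]
        refine sum_congr rfl fun i _ => ?_
        rw [← sum_filter, filter_mem_eq_inter,
          inter_eq_right.2 (tensorGrid_subset_sparseGrid hN hl),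
          sum_tensorGrid_abs_prod_psi fun n => l n - i n]

theorem lebesgueFun_le_prod {N : ℕ} (hN : 1 ≤ N) (L : ℕ) (y : Fin N → ℝ) :
    lebesgueFun N L y ≤ ∏ n, ∑ l ∈ Icc 1 (L + 1),
      (lagrangeLebesgueFun (nodes l) (y n) + lagrangeLebesgueFun (nodes (l - 1)) (y n)) := by
  calc lebesgueFun N L y
      ≤ ∑ l ∈ multiIndices N L, ∏ n, (lagrangeLebesgueFun (nodes (l n)) (y n) +
          lagrangeLebesgueFun (nodes (l n - 1)) (y n)) := by
        refine (lebesgueFun_le_sum hN L y).trans_eq (sum_congr rfl fun l _ => ?_)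
        exact sum_binaryIndices_prod fun n i => lagrangeLebesgueFun (nodes (l n - i)) (y n)
    _ ≤ ∑ l ∈ Fintype.piFinset fun _ : Fin N => Icc 1 (L + 1),
          ∏ n, (lagrangeLebesgueFun (nodes (l n)) (y n) +
            lagrangeLebesgueFun (nodes (l n - 1)) (y n)) :=
        sum_le_sum_of_subset_of_nonneg (filter_subset _ _) fun l _ _ => prod_nonneg fun n _ =>
          add_nonneg (lagrangeLebesgueFun_nonneg _ _) (lagrangeLebesgueFun_nonneg _ _)
    _ = _ := by rw [prod_univ_sum]

theorem lebesgueFun_le {N : ℕ} (hN : 1 ≤ N) (L : ℕ) {y : Fin N → ℝ} (hy : y ∈ Gam N) :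
    lebesgueFun N L y ≤ (((L : ℝ) + 1) * ((L : ℝ) + 2)) ^ N := by
  calc lebesgueFun N L y
      ≤ ∏ n, ∑ l ∈ Icc 1 (L + 1),
          (lagrangeLebesgueFun (nodes l) (y n) + lagrangeLebesgueFun (nodes (l - 1)) (y n)) :=
        lebesgueFun_le_prod hN L y
    _ ≤ ∏ _n : Fin N, ((L : ℝ) + 1) * ((L : ℝ) + 2) :=
        prod_le_prod (fun n _ => sum_nonneg fun l _ =>
          add_nonneg (lagrangeLebesgueFun_nonneg _ _) (lagrangeLebesgueFun_nonneg _ _))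
          fun n _ => sum_lagrangeLebesgueFun_nodes_le L (hy n (Set.mem_univ n))
    _ = _ := by rw [prod_const, card_univ, Fintype.card_fin]

end SparseGrid

theorem lemma4p3 (N L : ℕ) (hN : 1 ≤ N) (hL : 1 ≤ L) :
    SparseGrid.lebesgueConst N L ≤ (((L : ℝ) + 1) * ((L : ℝ) + 2)) ^ N := by
  obtain ⟨y, hy, h⟩ := (SparseGrid.isGreatest_lebesgueConst N L).1
  rw [← h]
  exact SparseGrid.lebesgueFun_le hN L hy
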